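/- A $\mathbb{Z}^d$-action $\mathbf{T}:\mathbb{Z}^d\curvearrowright X$ on a topological space $X$ is a family of homeomorphisms $\mathbf{T}^{\mathbf v}:X\to X$ ($\mathbf v\in\mathbb{Z}^d$) with $\mathbf{T}^{\mathbf 0}=\mathrm{id}$ and $\mathbf{T}^{\mathbf v+\mathbf w}=\mathbf{T}^{\mathbf v}\circ\mathbf{T}^{\mathbf w}$. It is free if $\mathbf{T}^{\mathbf v}(x)=x$ for some $x$ implies $\mathbf v=\mathbf 0$. Two $\mathbb{Z}^d$-actions $(X,\mathbf{T})$, $(Y,\mathbf{S})$ are (topologically) conjugate if there is a homeomorphism $\Phi:X\to Y$ with $\Phi\circ\mathbf{T}^{\mathbf v}=\mathbf{S}^{\mathbf v}\circ\Phi$ for all $\mathbf v$. A $\mathbb{Z}^{d_1}$-action $(X,\mathbf{T})$ and a $\mathbb{Z}^{d_2}$-action $(Y,\mathbf{S})$ are orbit equivalent if there is a homeomorphism $\Phi:X\to Y$ mapping the $\mathbf{T}$-orbit of each $x\in X$ onto the $\mathbf{S}$-orbit of $\Phi(x)$. A $\mathbb{Z}^d$-odometer is a $\mathbb{Z}^d$-action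 conjugate to the action of $\mathbb{Z}^d$ by coordinatewise translation on the inverse limit $\varprojlim_j \mathbb{Z}^d/G_j$ (with the topology inherited from the product of the discrete spaces $\mathbb{Z}^d/G_j$), for some decreasing sequence $G_1\supseteq G_2\supseteq\cdots$ of finite-index subgroups of $\mathbb{Z}^d$. A cone in $\mathbb{Z}^d$ is a set $\mathsf{C}=U\cap(\mathbb{Z}^d\setminus\{\mathbf 0\})$, where $U$ is a connected component of the complement in $\mathbb{R}^d$ of the union of $d$ distinct hyperplanes through the origin. Let $\mathbf{T}:\mathbb{Z}^{d_1}\curvearrowright X$. A cocycle for $\mathbf{T}$ is a function $\mathbf p:X\times\mathbb{Z}^{d_2}\to\mathbb{Z}^{d_1}$ with $\mathbf p(x,\mathbf 0)=\mathbf 0$ and $\mathbf p(x,\mathbf v)+\mathbf p(\mathbf{T}^{\mathbf p(x,\mathbf v)}(x),\mathbf w)=\mathbf p(x,\mathbf v+\mathbf w)$ for all $x,\mathbf v,\mathbf w$. For a cone $\mathsf{C}\subseteq\mathbb{Z}^{d_1}$, a $\mathsf{C}$-speedup of $\mathbf{T}$ is an action $\mathbf{S}:\mathbb{Z}^{d_2}\curvearrowright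 X$ by homeomorphisms for which there is a cocycle $\mathbf p$ for $\mathbf{T}$ such that $\mathbf{S}^{\mathbf v}(x)=\mathbf{T}^{\mathbf p(x,\mathbf v)}(x)$ for all $x,\mathbf v$, and $\mathbf p(x,\mathbf e_j)\in\mathsf{C}$ for all $x\in X$ and every standard basis vector $\mathbf e_j$ of $\mathbb{Z}^{d_2}$. **Theorem.** Let $(X_1,\mathbf{T}_1)$ be a free $\mathbb{Z}^d$-odometer and let $(X_2,T_2)$ be a free $\mathbb{Z}$-odometer. If $(X_1,\mathbf{T}_1)$ and $(X_2,T_2)$ are orbit equivalent, then for every cone $\mathsf{C}\subseteq\mathbb{Z}^d$ there is a $\mathsf{C}$-speedup $S:\mathbb{Z}\curvearrowright X_1$ of $\mathbf{T}_1$ that is topologically conjugate to $T_2$. -/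

import Mathlib

universe u v

/-- An action of `ℤ^d` by homeomorphisms on a topological space `X`. -/
structure ZdAction (d : ℕ) (X : Type u) [TopologicalSpace X] where
  /-- the homeomorphism `T^v` -/
  map : (Fin d → ℤ) → (X ≃ₜ X)
  map_zero : ∀ x, map 0 x = x
  map_add : ∀ v w x, map (v + w) x = map v (map w x)

namespace ZdAction

/-- The orbit of a point. -/
def orbit {d : ℕ} {X : Type u} [TopologicalSpace X] (T : ZdAction d X) (x : X) : Set X :=
  Set.range fun v : Fin d → ℤ => T.map v x

/-- Free actions: only the zero vector fixes a point. -/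
def IsFree {d : ℕ} {X : Type u} [TopologicalSpace X] (T : ZdAction d X) : Prop :=
  ∀ (x : X) (v : Fin d → ℤ), T.map v x = x → v = 0

/-- Topological conjugacy of two `ℤ^d`-actions. -/
def Conjugate {d : ℕ} {X : Type u} {Y : Type v} [TopologicalSpace X] [TopologicalSpace Y]
    (T : ZdAction d X) (S : ZdAction d Y) : Prop :=
  ∃ Φ : X ≃ₜ Y, ∀ (v : Fin d → ℤ) (x : X), Φ (T.map v x) = S.map v (Φ x)

/-- (Topological) orbit equivalence of a `ℤ^{d₁}`-action and a `ℤ^{d₂}`-action. -/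
def OrbitEquivalent {d₁ d₂ : ℕ} {X : Type u} {Y : Type v} [TopologicalSpace X]
    [TopologicalSpace Y] (T : ZdAction d₁ X) (S : ZdAction d₂ Y) : Prop :=
  ∃ Φ : X ≃ₜ Y, ∀ x : X, Φ '' T.orbit x = S.orbit (Φ x)

/-- Cocycles `X × ℤ^{d₂} → ℤ^{d₁}` for a `ℤ^{d₁}`-action. -/
def IsCocycle {d₁ d₂ : ℕ} {X : Type u} [TopologicalSpace X] (T : ZdAction d₁ X)
    (p : X → (Fin d₂ → ℤ) → (Fin d₁ → ℤ)) : Prop :=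
  (∀ x, p x 0 = 0) ∧ ∀ x v w, p x v + p (T.map (p x v) x) w = p x (v + w)

/-- `S` is a speedup of `T` with speedup cocycle `p`. -/
def IsSpeedupWith {d₁ d₂ : ℕ} {X : Type u} [TopologicalSpace X] (T : ZdAction d₁ X)
    (S : ZdAction d₂ X) (p : X → (Fin d₂ → ℤ) → (Fin d₁ → ℤ)) : Prop :=
  T.IsCocycle p ∧ ∀ v x, S.map v x = T.map (p x v) x

/-- `S` is a `C`-speedup of `T`: the values of the speedup cocycle at the standard basis
vectors all lie in `C`. -/
def IsConeSpeedup {d₁ d₂ : ℕ} {X : Type u} [TopologicalSpace X] (T : ZdAction d₁ X)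
    (S : ZdAction d₂ X) (C : Set (Fin d₁ → ℤ)) : Prop :=
  ∃ p : X → (Fin d₂ → ℤ) → (Fin d₁ → ℤ),
    T.IsSpeedupWith S p ∧ ∀ x (j : Fin d₂), p x (Pi.single j 1) ∈ C

end ZdAction

/-- A filled cone: a (nonempty) open connected set `U ⊆ ℝ^d` bounded by `d` distinct hyperplanes
through the origin: `U` meets none of them and its boundary lies in their union. In other words,
`U` is a connected component of the complement of `d` distinct hyperplanes through the origin. -/
def IsFilledCone {d : ℕ} (U : Set (Fin d → ℝ)) : Prop :=
  IsOpen U ∧ IsConnected U ∧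
    ∃ H : Fin d → Submodule ℝ (Fin d → ℝ),
      Function.Injective H ∧
      (∀ i, Module.finrank ℝ (H i) + 1 = d) ∧
      (∀ i, Disjoint U (H i : Set (Fin d → ℝ))) ∧
      frontier U ⊆ ⋃ i, (H i : Set (Fin d → ℝ))

/-- A cone in `ℤ^d`: the set of nonzero integer vectors in a filled cone. -/
def IsCone {d : ℕ} (C : Set (Fin d → ℤ)) : Prop :=
  ∃ U : Set (Fin d → ℝ), IsFilledCone U ∧
    C = {v : Fin d → ℤ | v ≠ 0 ∧ (fun i => (v i : ℝ)) ∈ U}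

/-- A decreasing sequence of finite-index subgroups of `ℤ^d`. -/
structure OdometerSeq (d : ℕ) where
  /-- the `j`-th subgroup -/
  grp : ℕ → AddSubgroup (Fin d → ℤ)
  anti : ∀ j, grp (j + 1) ≤ grp j
  finiteIndex : ∀ j, (grp j).FiniteIndex

namespace OdometerSeq

/-- The quotient map `ℤ^d / G_{j+1} → ℤ^d / G_j`. -/
def quot {d : ℕ} (G : OdometerSeq d) (j : ℕ) :
    (Fin d → ℤ) ⧸ G.grp (j + 1) →+ (Fin d → ℤ) ⧸ G.grp j :=
  QuotientAddGroup.map (G.grp (j + 1)) (G.grp j) (AddMonoidHom.id _) (G.anti j)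

/-- The inverse limit of the groups `ℤ^d / G_j`. Its topology is the subspace topology of the
product topology, each `ℤ^d / G_j` carrying the quotient topology, which is discrete. -/
def Space {d : ℕ} (G : OdometerSeq d) : Type :=
  {x : ∀ j, (Fin d → ℤ) ⧸ G.grp j // ∀ j, G.quot j (x (j + 1)) = x j}

instance {d : ℕ} (G : OdometerSeq d) : TopologicalSpace G.Space :=
  inferInstanceAs (TopologicalSpace
    {x : ∀ j, (Fin d → ℤ) ⧸ G.grp j // ∀ j, G.quot j (x (j + 1)) = x j})

theorem discreteTopology_quotient {d : ℕ} (G : OdometerSeq d) (j : ℕ) :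
    DiscreteTopology ((Fin d → ℤ) ⧸ G.grp j) :=
  QuotientAddGroup.discreteTopology (isOpen_discrete _)

/-- Translation of the inverse limit by `v ∈ ℤ^d` in every coordinate. -/
def shift {d : ℕ} (G : OdometerSeq d) (v : Fin d → ℤ) (x : G.Space) : G.Space :=
  ⟨fun j => x.1 j + (v : (Fin d → ℤ) ⧸ G.grp j), fun j => by
    rw [map_add, x.2 j]
    rfl⟩

theorem shift_zero {d : ℕ} (G : OdometerSeq d) (x : G.Space) : G.shift 0 x = x :=
  Subtype.ext (funext fun j => add_zero (x.1 j))

theorem shift_add {d : ℕ} (G : OdometerSeq d) (v w : Fin d → ℤ) (x : G.Space) :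
    G.shift (v + w) x = G.shift v (G.shift w x) :=
  Subtype.ext (funext fun j => by
    change x.1 j + ((v + w : Fin d → ℤ) : (Fin d → ℤ) ⧸ G.grp j) = x.1 j + w + v
    rw [QuotientAddGroup.mk_add, add_assoc, add_comm (w : (Fin d → ℤ) ⧸ G.grp j)])

theorem continuous_shift {d : ℕ} (G : OdometerSeq d) (v : Fin d → ℤ) :
    Continuous (G.shift v) :=
  Continuous.subtype_mk
    (continuous_pi fun j => ((continuous_apply j).comp continuous_subtype_val).add
      continuous_const) _

/-- The action of `ℤ^d` on the inverse limit by coordinatewise translation. -/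
def action {d : ℕ} (G : OdometerSeq d) : ZdAction d G.Space where
  map v :=
    { toFun := G.shift v
      invFun := G.shift (-v)
      left_inv := fun x => by rw [← shift_add, neg_add_cancel, shift_zero]
      right_inv := fun x => by rw [← shift_add, add_neg_cancel, shift_zero]
      continuous_toFun := G.continuous_shift v
      continuous_invFun := G.continuous_shift (-v) }
  map_zero := G.shift_zero
  map_add := G.shift_add

end OdometerSeq

/-- A `ℤ^d`-odometer: an action conjugate to the translation action on the inverse limit
of `ℤ^d / G_j` for some decreasing sequence `G_j` of finite-index subgroups. -/
def ZdAction.IsOdometer {d : ℕ} {X : Type u} [TopologicalSpace X] (T : ZdAction d X) : Prop :=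
  ∃ G : OdometerSeq d, T.Conjugate G.action

/-!
An orbit equivalence of free odometers matches clopen sets of equal Haar measure, so each index
`[ℤ^d : G_j]` divides some index `[ℤ : H_i]` and conversely (`OdometerSeq.exists_index_dvd_index`).
This is all that is used of the orbit equivalence, and it allows `G_j` to be replaced by a cofinal
sequence of subgroups `K_k` whose indices `n_k` are indices of subgroups `H_i`
(`AddSubgroup.exists_between_of_index_dvd`).

Fix `c` in the cone `C`. The heart of the proof is a walk `W : ℕ → ℤ^d` from `0`, with all
increments in `C`, which for every `k` runs through the cosets of `K_k` with period `n_k`, reaches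
the coset of `-c` at the end of each period, and whose increments within a period are the same in
every period. It is built by repeated extension (`IsCosetWalk.exists_extends`): translates of the
first period by representatives of the cosets of `K_{k+1}` in `K_k` are concatenated, and the
jumps from one to the next can be taken in `C` because `C` meets every coset of a finite-index
subgroup (`IsCone.exists_sub_mem`). The order of the translates is free, so the last one can be made
to end in the coset of `-c`; it is different from the first one because the end `w` of the first
period satisfies `w + c ∈ C`, hence `w + c ≠ 0`, and `K_{k+1}` is chosen so small that it does not
contain `w + c`.

The map `t ↦ W t` extends to a homeomorphism `Θ` from the inverse limit of the `ℤ / H_i` to that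
of the `ℤ^d / G_j`. At a point `z ≠ -1` some coordinate of `z` is not at the end of its period, and
there the increment of `W` is determined by that coordinate, so that `Θ (z + 1) = Θ z + v` for some
`v ∈ C`. At `z = -1` the same holds with `v = c`, since `Θ (-1) = -c` and `Θ 0 = 0`. Transporting
the `ℤ`-odometer by `Θ` gives the speedup; its cocycle identity follows from freeness.
-/

open MeasureTheory

/-! ### Inverse limits as compact groups -/

namespace OdometerSeq

variable {d : ℕ}

/-- The inverse limit as a subgroup of the product of the quotients `ℤ^d / G_j`. -/
def limitSubgroup (G : OdometerSeq d) : AddSubgroup (∀ j, (Fin d → ℤ) ⧸ G.grp j) where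
  carrier := {x | ∀ j, G.quot j (x (j + 1)) = x j}
  add_mem' hx hy j := by simp only [Pi.add_apply, map_add, hx j, hy j]
  zero_mem' j := by simp
  neg_mem' hx j := by simp only [Pi.neg_apply, map_neg, hx j]

instance (G : OdometerSeq d) : AddCommGroup G.Space :=
  inferInstanceAs (AddCommGroup G.limitSubgroup)

instance (G : OdometerSeq d) : IsTopologicalAddGroup G.Space :=
  inferInstanceAs (IsTopologicalAddGroup G.limitSubgroup)

instance (G : OdometerSeq d) (j : ℕ) : DiscreteTopology ((Fin d → ℤ) ⧸ G.grp j) :=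
  G.discreteTopology_quotient j

instance (G : OdometerSeq d) (j : ℕ) : Finite ((Fin d → ℤ) ⧸ G.grp j) :=
  haveI := G.finiteIndex j
  AddSubgroup.finite_quotient_of_finiteIndex

theorem continuous_coord (G : OdometerSeq d) (j : ℕ) : Continuous fun x : G.Space => x.1 j :=
  (continuous_apply j).comp continuous_subtype_val

instance (G : OdometerSeq d) : T2Space G.Space :=
  inferInstanceAs (T2Space {x : ∀ j, (Fin d → ℤ) ⧸ G.grp j // ∀ j, G.quot j (x (j + 1)) = x j})

instance (G : OdometerSeq d) : CompactSpace G.Space := by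
  have hc : IsClosed {x : ∀ j, (Fin d → ℤ) ⧸ G.grp j | ∀ j, G.quot j (x (j + 1)) = x j} := by
    simp only [Set.ofPred_forall]
    exact isClosed_iInter fun j =>
      isClosed_eq (continuous_of_discreteTopology.comp (continuous_apply (j + 1)))
        (continuous_apply j)
  exact isCompact_iff_compactSpace.mp hc.isCompact

theorem antitone_grp (G : OdometerSeq d) : Antitone G.grp := antitone_nat_of_succ_le G.anti

/-- A vector representing a later coordinate of a point represents all earlier ones. -/
theorem coord_eq_of_le (G : OdometerSeq d) (x : G.Space) {i j : ℕ} (hij : i ≤ j) {v : Fin d → ℤ}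
    (h : x.1 j = v) : x.1 i = v := by
  induction j, hij using Nat.le_induction with
  | base => exact h
  | succ j _ ih =>
    refine ih ?_
    rw [← x.2 j, h]
    rfl

theorem coord_eq_coord_of_le (G : OdometerSeq d) (x y : G.Space) {i j : ℕ} (hij : i ≤ j)
    (h : x.1 j = y.1 j) : x.1 i = y.1 i := by
  obtain ⟨v, hv⟩ := QuotientAddGroup.mk_surjective (y.1 j)
  rw [G.coord_eq_of_le x hij (h.trans hv.symm), G.coord_eq_of_le y hij hv.symm]

theorem space_ext (G : OdometerSeq d) {x y : G.Space} (h : ∀ j, x.1 j = y.1 j) : x = y :=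
  Subtype.ext (funext h)

/-- The point of the inverse limit determined by an integer vector. -/
def ofVec (G : OdometerSeq d) (v : Fin d → ℤ) : G.Space :=
  ⟨fun _ => (v : (Fin d → ℤ) ⧸ _), fun _ => rfl⟩

theorem action_map_apply (G : OdometerSeq d) (v : Fin d → ℤ) (x : G.Space) :
    G.action.map v x = G.shift v x := rfl

theorem shift_coord (G : OdometerSeq d) (v : Fin d → ℤ) (x : G.Space) (j : ℕ) :
    (G.shift v x).1 j = x.1 j + (v : (Fin d → ℤ) ⧸ G.grp j) := rfl

/-- The subgroups defining a free odometer have trivial intersection. -/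
theorem exists_notMem_of_isFree (G : OdometerSeq d) (hG : G.action.IsFree) {v : Fin d → ℤ}
    (hv : v ≠ 0) : ∃ j, v ∉ G.grp j := by
  by_contra! h
  refine hv (hG 0 v (G.space_ext fun j => ?_))
  rw [action_map_apply, shift_coord, (QuotientAddGroup.eq_zero_iff v).mpr (h j), add_zero]

/-- By compactness, a continuous map to a discrete space only depends on one coordinate. -/
theorem exists_level_of_continuous (G : OdometerSeq d) {F : Type*} [TopologicalSpace F]
    [DiscreteTopology F] {f : G.Space → F} (hf : Continuous f) :
    ∃ j, ∀ x y : G.Space, x.1 j = y.1 j → f x = f y := by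
  by_contra! h
  have hcl : ∀ j, IsClosed {p : G.Space × G.Space | p.1.1 j = p.2.1 j ∧ f p.1 ≠ f p.2} := by
    intro j
    refine (isClosed_eq ((G.continuous_coord j).comp continuous_fst)
      ((G.continuous_coord j).comp continuous_snd)).inter ?_
    exact (isClosed_discrete {q : F × F | q.1 ≠ q.2}).preimage
      ((hf.comp continuous_fst).prodMk (hf.comp continuous_snd))
  obtain ⟨p, hp⟩ := IsCompact.nonempty_iInter_of_sequence_nonempty_isCompact_isClosed
    (fun j => {p : G.Space × G.Space | p.1.1 j = p.2.1 j ∧ f p.1 ≠ f p.2})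
    (fun j p hp => ⟨G.coord_eq_coord_of_le _ _ j.le_succ hp.1, hp.2⟩)
    (fun j => by obtain ⟨x, y, hxy⟩ := h j; exact ⟨(x, y), hxy⟩)
    (hcl 0).isCompact hcl
  rw [Set.mem_iInter] at hp
  exact (hp 0).2 (congrArg f (G.space_ext fun j => (hp j).1))

end OdometerSeq

/-! ### Orbit equivalence and indices -/

/-- A measure invariant under a free `ℤ^d`-action is invariant under every homeomorphism that moves
points within orbits: the sets on which it agrees with a given element of the action are closed,
there are countably many of them, and by freeness they partition the space. -/
theorem ZdAction.measure_image_of_mem_orbit {d : ℕ} {X : Type*} [TopologicalSpace X] [T2Space X]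
    [MeasurableSpace X] [BorelSpace X] (T : ZdAction d X) (hfree : T.IsFree) (μ : Measure X)
    (hμ : ∀ v (A : Set X), μ (T.map v '' A) = μ A) (R : X ≃ₜ X) (hR : ∀ x, R x ∈ T.orbit x)
    {A : Set X} (hA : MeasurableSet A) : μ (R '' A) = μ A := by
  set E : (Fin d → ℤ) → Set X := fun v => {x | R x = T.map v x} with hE
  have hEm : ∀ v, MeasurableSet (E v) := fun v =>
    (isClosed_eq R.continuous (T.map v).continuous).measurableSet
  have hdisj : Pairwise fun v w => Disjoint (E v) (E w) := by
    intro v w hvw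
    refine Set.disjoint_left.mpr fun x hv hw => hvw ?_
    have h : T.map v x = T.map w x := (show R x = _ from hv).symm.trans hw
    have h2 : T.map (v - w) (T.map w x) = T.map w x := by
      rw [← T.map_add, sub_add_cancel, h]
    exact sub_eq_zero.mp (hfree _ _ h2)
  have hcover : A = ⋃ v, A ∩ E v := by
    rw [← Set.inter_iUnion, eq_comm, Set.inter_eq_left]
    intro x _
    obtain ⟨v, hv⟩ := hR x
    exact Set.mem_iUnion.mpr ⟨v, hv.symm⟩
  have hpiece : ∀ v, R '' (A ∩ E v) = T.map v '' (A ∩ E v) := fun v =>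
    Set.image_congr fun x hx => hx.2
  have hAE : ∀ v, MeasurableSet (A ∩ E v) := fun v => hA.inter (hEm v)
  have hd : Pairwise fun v w => Disjoint (A ∩ E v) (A ∩ E w) := fun v w h =>
    (hdisj h).mono Set.inter_subset_right Set.inter_subset_right
  calc μ (R '' A) = μ (⋃ v, R '' (A ∩ E v)) := by rw [← Set.image_iUnion, ← hcover]
    _ = ∑' v, μ (R '' (A ∩ E v)) := by
        refine measure_iUnion (fun v w h => ?_) fun v => ?_
        · exact (Set.disjoint_image_iff R.injective).mpr (hd h)
        · exact R.measurableEmbedding.measurableSet_image.mpr (hAE v)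
    _ = ∑' v, μ (A ∩ E v) := by simp_rw [hpiece, hμ]
    _ = μ A := by rw [← measure_iUnion hd hAE, ← hcover]

namespace OdometerSeq

/-- Orbit equivalence of free odometers forces each index of the first to divide some index of the
second. The level sets of a coordinate of the first system are carried to clopen sets of the second
which have the same Haar measure, and each of which is a union of cylinder sets of one level. -/
theorem exists_index_dvd_index {d₁ d₂ : ℕ} (G : OdometerSeq d₁) (H : OdometerSeq d₂)
    (hH : H.action.IsFree) (Φ : H.Space ≃ₜ G.Space)
    (hΦ : ∀ x v, Φ.symm (G.shift v x) ∈ H.action.orbit (Φ.symm x)) (j : ℕ) :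
    ∃ i, (G.grp j).index ∣ (H.grp i).index := by
  obtain ⟨i, hi⟩ := H.exists_level_of_continuous
    (f := fun y => (Φ y).1 j) ((G.continuous_coord j).comp Φ.continuous)
  refine ⟨i, ?_⟩
  let : MeasurableSpace H.Space := borel _
  have : BorelSpace H.Space := ⟨rfl⟩
  let μ : Measure H.Space := Measure.addHaar
  have hcylm : ∀ b, MeasurableSet {y : H.Space | y.1 i = b} := fun b =>
    (isClosed_singleton.preimage (H.continuous_coord i)).measurableSet
  -- all cylinders of level `i` are translates of the one through `0`
  have hcyl : ∀ b, μ {y : H.Space | y.1 i = b} = μ {y : H.Space | y.1 i = 0} := by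
    intro b
    obtain ⟨v, rfl⟩ := QuotientAddGroup.mk_surjective b
    rw [← measure_preimage_add_right μ (H.ofVec v)]
    congr 1
    ext y
    change y.1 i + (v : (Fin d₂ → ℤ) ⧸ H.grp i) = v ↔ y.1 i = 0
    simp
  set κ := μ {y : H.Space | y.1 i = 0} with hκ
  have hinv : ∀ v (A : Set H.Space), μ (H.action.map v '' A) = μ A := by
    intro v A
    rw [← measure_preimage_add_right μ (H.ofVec v) (H.action.map v '' A)]
    congr 1
    exact (H.action.map v).injective.preimage_image A
  let g : (Fin d₂ → ℤ) ⧸ H.grp i → (Fin d₁ → ℤ) ⧸ G.grp j :=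
    fun b => (Φ (H.ofVec b.out)).1 j
  have hg : ∀ y : H.Space, (Φ y).1 j = g (y.1 i) := fun y =>
    hi y _ (QuotientAddGroup.out_eq' _).symm
  have := Fintype.ofFinite ((Fin d₂ → ℤ) ⧸ H.grp i)
  have := Fintype.ofFinite ((Fin d₁ → ℤ) ⧸ G.grp j)
  classical
  have hsum : ∀ s : Finset ((Fin d₂ → ℤ) ⧸ H.grp i),
      μ {y : H.Space | y.1 i ∈ s} = s.card * κ := by
    intro s
    have : {y : H.Space | y.1 i ∈ s} = ⋃ b ∈ s, {y : H.Space | y.1 i = b} := by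
      ext y; simp
    rw [this, measure_biUnion_finset _ fun b _ => hcylm b]
    · simp [hcyl]
    · intro b _ c _ hbc
      exact Set.disjoint_left.mpr fun y hb hc => hbc (hb.symm.trans hc)
  have hκ0 : κ ≠ 0 := by
    intro h0
    have h1 := hsum Finset.univ
    rw [h0, mul_zero] at h1
    simp only [Finset.mem_univ] at h1
    exact (isOpen_univ.measure_pos μ ⟨0, trivial⟩).ne' h1
  have hκt : κ ≠ ⊤ := measure_ne_top μ _
  let fib := fun a => Finset.univ.filter fun b => g b = a
  have hfib : ∀ a, μ {y : H.Space | (Φ y).1 j = a} = (fib a).card * κ := by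
    intro a
    rw [← hsum]
    congr 1
    ext y
    simp [fib, hg]
  -- the translation by `v` on the first system preserves `μ`, hence all fibres have equal size
  have hcard : ∀ a, (fib a).card = (fib 0).card := by
    intro a
    obtain ⟨v, rfl⟩ := QuotientAddGroup.mk_surjective a
    let R : H.Space ≃ₜ H.Space := (Φ.trans (G.action.map v)).trans Φ.symm
    have hR : ∀ y, R y ∈ H.action.orbit y := fun y => by
      have h := hΦ (Φ y) v
      rw [Φ.symm_apply_apply] at h
      exact h
    have h1 := H.action.measure_image_of_mem_orbit hH μ hinv R hR
      (A := {y | (Φ y).1 j = 0})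
      (isClosed_singleton.preimage ((G.continuous_coord j).comp Φ.continuous)).measurableSet
    have h2 : R '' {y | (Φ y).1 j = 0} = {y | (Φ y).1 j = (v : (Fin d₁ → ℤ) ⧸ G.grp j)} := by
      rw [R.image_eq_preimage_symm]
      ext y
      change (Φ (Φ.symm (G.shift (-v) (Φ y)))).1 j = 0 ↔ (Φ y).1 j = v
      rw [Φ.apply_symm_apply, shift_coord, QuotientAddGroup.mk_neg, add_neg_eq_zero]
    rw [h2, hfib, hfib, ENNReal.mul_left_inj hκ0 hκt] at h1
    exact_mod_cast h1
  have htot : (H.grp i).index = (G.grp j).index * (fib 0).card := by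
    have h := Finset.card_eq_sum_card_fiberwise (f := g) (s := Finset.univ) (t := Finset.univ)
      fun _ _ => Finset.mem_coe.mpr (Finset.mem_univ _)
    rw [Finset.sum_congr rfl fun a _ => hcard a] at h
    simpa [AddSubgroup.index, Nat.card_eq_fintype_card] using h
  exact ⟨_, htot⟩

end OdometerSeq

/-! ### Cones -/

/-- A connected set avoiding a hyperplane lies strictly on one side of it. -/
theorem exists_forall_pos_of_disjoint_hyperplane {d : ℕ} {U : Set (Fin d → ℝ)}
    (hU : IsPreconnected U) (H : Submodule ℝ (Fin d → ℝ)) (hH : Module.finrank ℝ H + 1 = d)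
    (hd : Disjoint U (H : Set (Fin d → ℝ))) :
    ∃ f : (Fin d → ℝ) →ₗ[ℝ] ℝ, (∀ x ∈ H, f x = 0) ∧ ∀ x ∈ U, 0 < f x := by
  obtain ⟨f, hf⟩ : ∃ f : (Fin d → ℝ) →ₗ[ℝ] ℝ, LinearMap.ker f = H := by
    have h1 : Module.finrank ℝ ((Fin d → ℝ) ⧸ H) = 1 := by
      have := H.finrank_quotient_add_finrank
      rw [Module.finrank_fin_fun] at this
      omega
    let e := LinearEquiv.ofFinrankEq (R := ℝ) ((Fin d → ℝ) ⧸ H) ℝ (by simpa using h1)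
    exact ⟨e.toLinearMap ∘ₗ H.mkQ, by simp [LinearMap.ker_comp]⟩
  have hfc : Continuous f := f.continuous_of_finiteDimensional
  have hne : ∀ x ∈ U, f x ≠ 0 := fun x hx h0 =>
    Set.disjoint_left.mp hd hx (by rw [SetLike.mem_coe, ← hf]; exact h0)
  have hker : ∀ x ∈ H, f x = 0 := fun x hx => by rw [← hf] at hx; exact hx
  by_cases hpos : ∀ x ∈ U, 0 < f x
  · exact ⟨f, hker, hpos⟩
  · push Not at hpos
    obtain ⟨a, ha, hfa⟩ := hpos
    refine ⟨-f, fun x hx => by simp [hker x hx], fun x hx => ?_⟩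
    rw [LinearMap.neg_apply, neg_pos]
    by_contra! hx0
    obtain ⟨y, hy, hy0⟩ := hU.intermediate_value ha hx hfc.continuousOn ⟨hfa, hx0⟩
    exact hne y hy hy0

/-- A preconnected set that meets an open set `U` but not its frontier lies in `U`. -/
theorem subset_of_frontier_subset {X : Type*} [TopologicalSpace X] {U V B : Set X}
    (hUo : IsOpen U) (hB : frontier U ⊆ B) (hV : IsPreconnected V) (hVU : (V ∩ U).Nonempty)
    (hVB : Disjoint V B) : V ⊆ U := by
  by_contra hsub
  obtain ⟨x, hxV, hxU⟩ := Set.not_subset.mp hsub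
  obtain ⟨y, hyV, hyU⟩ := hVU
  refine (hV U (closure U)ᶜ hUo isClosed_closure.isOpen_compl (fun z hz => ?_)
    ⟨y, hyV, hyU⟩ ⟨x, hxV, fun hxc => ?_⟩).elim fun z hz =>
      hz.2.2 (subset_closure hz.2.1)
  · by_cases hzU : z ∈ U
    · exact Or.inl hzU
    · refine Or.inr fun hzc => Set.disjoint_left.mp hVB hz (hB ?_)
      rw [hUo.frontier_eq]
      exact ⟨hzc, hzU⟩
  · refine Set.disjoint_left.mp hVB hxV (hB ?_)
    rw [hUo.frontier_eq]
    exact ⟨hxc, hxU⟩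

/-- Filled cones are closed under nonzero nonnegative linear combinations: a filled cone is the
convex set of all points lying on the same side of each of its hyperplanes. -/
theorem IsFilledCone.smul_add_smul_mem {d : ℕ} {U : Set (Fin d → ℝ)} (hU : IsFilledCone U)
    {x y : Fin d → ℝ} (hx : x ∈ U) (hy : y ∈ U) {a b : ℝ} (ha : 0 ≤ a) (hb : 0 ≤ b)
    (hab : 0 < a + b) : a • x + b • y ∈ U := by
  obtain ⟨hUo, hUc, H, -, hH, hd, hfr⟩ := hU
  choose f hf0 hfpos using fun i =>
    exists_forall_pos_of_disjoint_hyperplane hUc.isPreconnected (H i) (hH i) (hd i)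
  let V : Set (Fin d → ℝ) := {z | ∀ i, 0 < f i z}
  have hconv : Convex ℝ V := by
    intro z hz w hw s t hs ht hst i
    have h1 := hz i
    have h2 := hw i
    simp only [map_add, map_smul, smul_eq_mul]
    rcases hs.eq_or_lt with rfl | hs
    · obtain rfl : t = 1 := by linarith
      linarith
    · have := mul_pos hs h1
      have := mul_nonneg ht h2.le
      linarith
  have hVU : V ⊆ U := by
    refine subset_of_frontier_subset hUo hfr hconv.isPreconnected
      ⟨x, fun i => hfpos i x hx, hx⟩ (Set.disjoint_left.mpr fun z hz hzH => ?_)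
    obtain ⟨i, hi⟩ := Set.mem_iUnion.mp hzH
    exact (hz i).ne' (hf0 i z hi)
  refine hVU fun i => ?_
  have h1 := hfpos i x hx
  have h2 := hfpos i y hy
  simp only [map_add, map_smul, smul_eq_mul]
  rcases ha.eq_or_lt with rfl | ha
  · have : 0 < b := by linarith
    have := mul_pos this h2
    linarith
  · have := mul_pos ha h1
    have := mul_nonneg hb h2.le
    linarith

theorem IsFilledCone.zero_notMem {d : ℕ} (hd : d ≠ 0) {U : Set (Fin d → ℝ)}
    (hU : IsFilledCone U) : 0 ∉ U := by
  obtain ⟨-, -, H, -, -, hdis, -⟩ := hU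
  exact fun h => Set.disjoint_left.mp (hdis ⟨0, Nat.pos_of_ne_zero hd⟩) h (zero_mem _)

theorem IsCone.zero_notMem {d : ℕ} {C : Set (Fin d → ℤ)} (hC : IsCone C) : 0 ∉ C := by
  obtain ⟨U, -, rfl⟩ := hC
  exact fun h => h.1 rfl

theorem IsCone.add_mem {d : ℕ} {C : Set (Fin d → ℤ)} (hC : IsCone C) {v w : Fin d → ℤ}
    (hv : v ∈ C) (hw : w ∈ C) : v + w ∈ C := by
  obtain ⟨U, hU, rfl⟩ := hC
  have hd : d ≠ 0 := by
    rintro rfl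
    exact hv.1 (Subsingleton.elim _ _)
  have h := hU.smul_add_smul_mem hv.2 hw.2 (zero_le_one' ℝ) (zero_le_one' ℝ) (by norm_num)
  have he : (fun i => (((v + w) i : ℤ) : ℝ)) =
      (1 : ℝ) • (fun i => (v i : ℝ)) + (1 : ℝ) • fun i => (w i : ℝ) := by
    ext i; simp
  refine ⟨fun h0 => hU.zero_notMem hd ?_, by rw [he]; exact h⟩
  rw [← he, h0] at h
  simpa [Pi.zero_def] using h

/-- A cone meets every coset of a finite-index subgroup, as it contains arbitrarily large balls. -/
theorem IsCone.exists_sub_mem {d : ℕ} (hd : d ≠ 0) {C : Set (Fin d → ℤ)} (hC : IsCone C)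
    (K : AddSubgroup (Fin d → ℤ)) [K.FiniteIndex] (v : Fin d → ℤ) : ∃ w ∈ C, w - v ∈ K := by
  obtain ⟨U, hU, rfl⟩ := hC
  obtain ⟨u, hu⟩ := hU.2.1.nonempty
  obtain ⟨ε, hε, hball⟩ := Metric.isOpen_iff.mp hU.1 u hu
  have hN : (0 : ℝ) < (K.index : ℝ) := by exact_mod_cast Nat.pos_of_ne_zero K.index_ne_zero_of_finite
  set N : ℝ := (K.index : ℝ) with hNdef
  -- `l` is large enough for the ball of radius `l * ε` to contain a cube of side `N`
  set l : ℝ := 2 * N / ε with hl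
  have hlpos : 0 < l := by positivity
  let z : Fin d → ℤ := fun i => ⌊(l * u i - v i) / N⌋
  let w : Fin d → ℤ := v + K.index • z
  have hw : ∀ i, |(w i : ℝ) - l * u i| ≤ N := by
    intro i
    have h1 : (z i : ℝ) ≤ (l * u i - v i) / N := Int.floor_le _
    have h2 : (l * u i - v i) / N < z i + 1 := Int.lt_floor_add_one _
    rw [le_div_iff₀ hN] at h1
    rw [div_lt_iff₀ hN] at h2
    have h3 : (w i : ℝ) = v i + N * z i := by simp [w, N]
    rw [h3, abs_le]
    constructor <;> linarith
  have hmem : (fun i => l⁻¹ * (w i : ℝ)) ∈ U := by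
    refine hball ?_
    rw [Metric.mem_ball, dist_pi_lt_iff hε]
    intro i
    have h4 : l⁻¹ * (w i : ℝ) - u i = l⁻¹ * (w i - l * u i) := by
      field_simp
    rw [Real.dist_eq, h4, abs_mul, abs_of_pos (inv_pos.mpr hlpos)]
    calc l⁻¹ * |(w i : ℝ) - l * u i| ≤ l⁻¹ * N := by
          gcongr
          exact hw i
      _ = ε / 2 := by rw [hl]; field_simp
      _ < ε := by linarith
  have hwU : (fun i => (w i : ℝ)) ∈ U := by
    have h := hU.smul_add_smul_mem hmem hmem hlpos.le le_rfl (by linarith)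
    have he : l • (fun i => l⁻¹ * (w i : ℝ)) + (0 : ℝ) • (fun i => l⁻¹ * (w i : ℝ)) =
        fun i => (w i : ℝ) := by
      ext i
      simp [hlpos.ne']
    rwa [he] at h
  refine ⟨w, ⟨fun h0 => hU.zero_notMem hd ?_, hwU⟩, ?_⟩
  · simpa [h0, Pi.zero_def] using hwU
  · rw [add_sub_cancel_left]
    exact K.nsmul_index_mem z

/-! ### Subgroups of prescribed index and coset walks -/

/-- A finite abelian group has a subgroup of every order dividing its own. -/
theorem exists_addSubgroup_card_eq {e : ℕ} : ∀ {Q : Type*} [AddCommGroup Q] [Finite Q],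
    e ∣ Nat.card Q → ∃ P : AddSubgroup Q, Nat.card P = e := by
  induction e using Nat.recOnMul with
  | zero =>
    intro Q _ _ h
    exact absurd (zero_dvd_iff.mp h) Nat.card_pos.ne'
  | one => exact fun _ => ⟨⊥, AddSubgroup.card_bot⟩
  | prime p hp =>
    intro Q _ _ h
    have := Fact.mk hp
    obtain ⟨x, hx⟩ := exists_prime_addOrderOf_dvd_card' p h
    exact ⟨AddSubgroup.zmultiples x, by rw [Nat.card_zmultiples, hx]⟩
  | mul a b iha ihb =>
    intro Q _ _ h
    obtain ⟨R, hR⟩ := iha (dvd_trans (dvd_mul_right a b) h)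
    have hcard : Nat.card Q = Nat.card (Q ⧸ R) * Nat.card R := R.card_eq_card_quotient_mul_card_addSubgroup
    have ha : 0 < a := hR ▸ Nat.card_pos
    obtain ⟨P, hP⟩ := ihb (Q := Q ⧸ R) (by
      rw [hcard, hR, mul_comm] at h
      exact Nat.dvd_of_mul_dvd_mul_right ha h)
    refine ⟨P.comap (QuotientAddGroup.mk' R), ?_⟩
    have hle : R ≤ P.comap (QuotientAddGroup.mk' R) := fun x hx => by
      rw [AddSubgroup.mem_comap, QuotientAddGroup.mk'_apply, (QuotientAddGroup.eq_zero_iff x).mpr hx]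
      exact P.zero_mem
    have h1 := AddSubgroup.relIndex_mul_relIndex ⊥ R (P.comap (QuotientAddGroup.mk' R)) bot_le hle
    have h2 := AddSubgroup.relIndex_ker (P.comap (QuotientAddGroup.mk' R))
      (QuotientAddGroup.mk' R)
    rw [QuotientAddGroup.ker_mk',
      AddSubgroup.map_comap_eq_self_of_surjective (QuotientAddGroup.mk'_surjective R)] at h2
    rw [AddSubgroup.relIndex_bot_left, AddSubgroup.relIndex_bot_left, hR, h2, hP] at h1
    exact h1.symm

/-- Between two subgroups of finite index there is one of each index allowed by divisibility. -/
theorem AddSubgroup.exists_between_of_index_dvd {A : Type*} [AddCommGroup A] {K L : AddSubgroup A}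
    (hKL : K ≤ L) [K.FiniteIndex] {n : ℕ} (h1 : L.index ∣ n) (h2 : n ∣ K.index) :
    ∃ M : AddSubgroup A, K ≤ M ∧ M ≤ L ∧ M.index = n := by
  have hn : 0 < n := Nat.pos_of_dvd_of_pos h2 (Nat.pos_of_ne_zero K.index_ne_zero_of_finite)
  obtain ⟨e, he⟩ := h2
  have he0 : 0 < e := by
    refine Nat.pos_of_ne_zero fun h0 => K.index_ne_zero_of_finite ?_
    rw [he, h0, mul_zero]
  set π := QuotientAddGroup.mk' K with hπ
  have hcard : ∀ M : AddSubgroup A, K.relIndex M = Nat.card (M.map π) := fun M => by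
    have := AddSubgroup.relIndex_ker M π
    rwa [hπ, QuotientAddGroup.ker_mk'] at this
  have : Finite (A ⧸ K) := K.finite_quotient_of_finiteIndex
  obtain ⟨P, hP⟩ := exists_addSubgroup_card_eq (e := e) (Q := L.map π) (by
    rw [← hcard]
    obtain ⟨f, hf⟩ := h1
    have hL := AddSubgroup.relIndex_mul_index hKL
    have hL0 : 0 < L.index := Nat.pos_of_ne_zero fun h0 => by simp [hf, h0] at hn
    refine ⟨f, Nat.eq_of_mul_eq_mul_right hL0 ?_⟩
    rw [hL, he, hf]
    ring)
  have hKM : K ≤ (P.map (L.map π).subtype).comap π := fun x hx => by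
    rw [AddSubgroup.mem_comap, show π x = 0 from (QuotientAddGroup.eq_zero_iff x).mpr hx]
    exact zero_mem _
  refine ⟨(P.map (L.map π).subtype).comap π, hKM, fun x hx => ?_, ?_⟩
  · obtain ⟨⟨y, z, hz, rfl⟩, -, hy⟩ := hx
    have h3 : z - x ∈ K := by
      rw [← QuotientAddGroup.eq_zero_iff]
      exact sub_eq_zero.mpr hy
    have := L.sub_mem hz (hKL h3)
    rwa [sub_sub_cancel] at this
  · have h3 := AddSubgroup.relIndex_mul_index hKM
    rw [hcard, AddSubgroup.map_comap_eq_self_of_surjective (QuotientAddGroup.mk'_surjective K),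
      AddSubgroup.card_map_of_injective (AddSubgroup.subtype_injective _), hP, he, mul_comm n] at h3
    exact Nat.eq_of_mul_eq_mul_left he0 h3

/-- A periodic enumeration of a finite type, with prescribed first and last entries. -/
theorem exists_periodic_enumeration {Q : Type*} [Finite Q] {r : ℕ} (hr : Nat.card Q = r)
    {a b : Q} (hab : a ≠ b) :
    ∃ e : ℕ → Q, e 0 = a ∧ e (r - 1) = b ∧ ∀ s t, e s = e t ↔ s ≡ t [MOD r] := by
  classical
  have : Nontrivial Q := ⟨a, b, hab⟩
  have h1 : 1 < r := hr ▸ Finite.one_lt_card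
  have e₀ : Q ≃ Fin r := Finite.equivFinOfCardEq hr
  let z : Fin r := ⟨0, by omega⟩
  let l : Fin r := ⟨r - 1, by omega⟩
  have hzl : z ≠ l := fun h => by
    have := congrArg Fin.val h
    simp only [z, l] at this
    omega
  let e₁ : Q ≃ Fin r := e₀.trans (Equiv.swap (e₀ a) z)
  have ha1 : e₁ a = z := by simp [e₁]
  let e₂ : Q ≃ Fin r := e₁.trans (Equiv.swap (e₁ b) l)
  have ha2 : e₂ a = z := by
    change Equiv.swap (e₁ b) l (e₁ a) = z
    rw [ha1]
    exact Equiv.swap_apply_of_ne_of_ne (fun h => hab (e₁.injective (ha1.trans h))) hzl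
  have hb2 : e₂ b = l := by simp [e₂]
  refine ⟨fun t => e₂.symm ⟨t % r, Nat.mod_lt _ (by omega)⟩, ?_, ?_, fun s t => ?_⟩
  · rw [Equiv.symm_apply_eq, ha2]
    simp [z]
  · rw [Equiv.symm_apply_eq, hb2]
    simp [l, Nat.mod_eq_of_lt (show r - 1 < r by omega)]
  · rw [e₂.symm.injective.eq_iff, Fin.mk.injEq]
    rfl

/-- Periodic enumeration of the cosets of `K'` in `K`, starting with `K'` itself and whose last
entry is the coset of a prescribed `u ∉ K'`. -/
theorem AddSubgroup.exists_periodic_coset_enumeration {A : Type*} [AddCommGroup A]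
    {K K' : AddSubgroup A} [K'.FiniteIndex] {u : A} (hu : u ∈ K) (hu' : u ∉ K') :
    ∃ γ : ℕ → A, γ 0 ∈ K' ∧ γ (K'.relIndex K - 1) - u ∈ K' ∧ (∀ a, γ a ∈ K) ∧
      ∀ a b, γ a - γ b ∈ K' ↔ a ≡ b [MOD K'.relIndex K] := by
  have key : ∀ x y : K, (x : K ⧸ K'.addSubgroupOf K) = y ↔ (x : A) - y ∈ K' := fun x y => by
    rw [← sub_eq_zero, ← QuotientAddGroup.mk_sub, QuotientAddGroup.eq_zero_iff,
      AddSubgroup.mem_addSubgroupOf]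
    rfl
  have : Finite (K ⧸ K'.addSubgroupOf K) := AddSubgroup.finite_quotient_of_finiteIndex
  obtain ⟨e, h0, h1, h2⟩ := exists_periodic_enumeration
    (Q := K ⧸ K'.addSubgroupOf K) (r := K'.relIndex K) rfl (a := 0) (b := ((⟨u, hu⟩ : K) : _))
    (fun h => hu' (by
      have := (key 0 ⟨u, hu⟩).mp h
      simpa using this))
  refine ⟨fun a => ((e a).out : K), ?_, ?_, fun a => SetLike.coe_mem _, fun a b => ?_⟩
  · have := (key (e 0).out 0).mp (by rw [QuotientAddGroup.out_eq', h0]; rfl)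
    simpa using this
  · exact (key (e _).out ⟨u, hu⟩).mp (by rw [QuotientAddGroup.out_eq', h1])
  · rw [← key, QuotientAddGroup.out_eq', QuotientAddGroup.out_eq', h2]

/-- A walk in `ℤ^d` with increments in `C` that starts at `0`, runs periodically through all cosets
of `K`, and visits the coset of `-c` at the end of each period. -/
structure IsCosetWalk {d : ℕ} (C : Set (Fin d → ℤ)) (c : Fin d → ℤ) (K : AddSubgroup (Fin d → ℤ))
    (w : ℕ → Fin d → ℤ) : Prop where
  zero : w 0 = 0
  step : ∀ t, w (t + 1) - w t ∈ C
  sub_mem_iff : ∀ s t, w s - w t ∈ K ↔ s ≡ t [MOD K.index]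
  last : w (K.index - 1) + c ∈ K

namespace IsCosetWalk

variable {d : ℕ} {C : Set (Fin d → ℤ)} {c : Fin d → ℤ} {K K' : AddSubgroup (Fin d → ℤ)}
  {w w' : ℕ → Fin d → ℤ}

/-- The walk `w'` agrees with `w` before time `K.index`, modulo `K`, and in all increments except
those at the ends of periods of `w`. -/
structure Extends (K : AddSubgroup (Fin d → ℤ)) (w w' : ℕ → Fin d → ℤ) : Prop where
  eq_of_lt : ∀ t < K.index, w' t = w t
  sub_mem : ∀ t, w' t - w t ∈ K
  increment : ∀ t, ¬ K.index ∣ t + 1 →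
    w' (t + 1) - w' t = w (t % K.index + 1) - w (t % K.index)

theorem add_pos_mem (hC : IsCone C) (hc : c ∈ C) (hw : IsCosetWalk C c K w) (t : ℕ) :
    w t + c ∈ C := by
  induction t with
  | zero => rwa [hw.zero, zero_add]
  | succ t ih =>
    have := hC.add_mem ih (hw.step t)
    rwa [show w t + c + (w (t + 1) - w t) = w (t + 1) + c by abel] at this

/-- A coset walk of `K` extends to one of a smaller subgroup: translates of the first period,
one for each coset of `K'` in `K`, are joined by increments in the cone. -/
theorem exists_extends (hC : IsCone C) (hd : d ≠ 0) [K'.FiniteIndex] (hK : K' ≤ K)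
    (hw : IsCosetWalk C c K w) (hlast : w (K.index - 1) + c ∉ K') :
    ∃ w', IsCosetWalk C c K' w' ∧ Extends K w w' := by
  have hKfin : K.FiniteIndex := AddSubgroup.finiteIndex_of_le hK
  have hn : 0 < K.index := Nat.pos_of_ne_zero K.index_ne_zero_of_finite
  have hidx : K'.relIndex K * K.index = K'.index := AddSubgroup.relIndex_mul_index hK
  have hr : 0 < K'.relIndex K := Nat.pos_of_ne_zero fun h0 => by
    rw [h0, zero_mul] at hidx
    exact K'.index_ne_zero_of_finite hidx.symm
  obtain ⟨γ, hγ0, hγl, hγK, hγ⟩ := AddSubgroup.exists_periodic_coset_enumeration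
    (K := K) (K' := K') (neg_mem hw.last) (fun h => hlast (neg_mem_iff.mp h))
  set n := K.index with hndef
  set r := K'.relIndex K with hrdef
  have hpick : ∀ x y : Fin d → ℤ, ∃ z, z - x ∈ C ∧ z - y ∈ K' := fun x y => by
    obtain ⟨v, hv, hvK⟩ := hC.exists_sub_mem hd K' (y - x)
    exact ⟨v + x, by rwa [add_sub_cancel_right], by rwa [← sub_sub_eq_add_sub] at *⟩
  choose pick hpC hpK using hpick
  -- the starting points of the translates of the first period
  let β : ℕ → Fin d → ℤ := fun a => Nat.rec 0 (fun a b => pick (b + w (n - 1)) (γ (a + 1))) a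
  have hβ0 : β 0 = 0 := rfl
  have hβC : ∀ a, β (a + 1) - (β a + w (n - 1)) ∈ C := fun a => hpC _ _
  have hβγ : ∀ a, β a - γ a ∈ K' := fun a => by
    cases a with
    | zero => rw [hβ0, zero_sub]; exact neg_mem hγ0
    | succ a => exact hpK _ _
  have hβK : ∀ a, β a ∈ K := fun a => by
    have := add_mem (hK (hβγ a)) (hγK a)
    rwa [sub_add_cancel] at this
  have hβiff : ∀ a b, β a - β b ∈ K' ↔ a ≡ b [MOD r] := fun a b => by
    rw [← hγ, show β a - β b = (γ a - γ b) + ((β a - γ a) - (β b - γ b)) by abel]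
    exact K'.add_mem_cancel_right (sub_mem (hβγ a) (hβγ b))
  let w' : ℕ → Fin d → ℤ := fun t => β (t / n) + w (t % n)
  have hwK : ∀ t, w' t - w t ∈ K := fun t => by
    have h1 : w (t % n) - w t ∈ K := (hw.sub_mem_iff _ _).mpr (Nat.mod_modEq t n)
    have := add_mem (hβK (t / n)) h1
    rwa [← add_sub_assoc] at this
  have hinc : ∀ t, ¬ n ∣ t + 1 → w' (t + 1) - w' t = w (t % n + 1) - w (t % n) := fun t ht => by
    have h1 : (t + 1) / n = t / n := Nat.succ_div_of_not_dvd ht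
    have h2 : (t + 1) % n = t % n + 1 := by
      have e1 := Nat.div_add_mod (t + 1) n
      have e2 := Nat.div_add_mod t n
      rw [h1] at e1
      omega
    simp only [w', h1, h2]
    abel
  refine ⟨w', ⟨?_, fun t => ?_, fun s t => ?_, ?_⟩, fun t ht => ?_, hwK, hinc⟩
  · simp [w', hβ0, hw.zero]
  · by_cases ht : n ∣ t + 1
    · have h1 : (t + 1) / n = t / n + 1 := Nat.succ_div_of_dvd ht
      have h2 : (t + 1) % n = 0 := Nat.mod_eq_zero_of_dvd ht
      have h3 : t % n = n - 1 := by
        have e1 := Nat.div_add_mod (t + 1) n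
        have e2 := Nat.div_add_mod t n
        rw [h1, h2, mul_add] at e1
        omega
      simp only [w', h1, h2, h3, hw.zero, add_zero]
      exact hβC _
    · rw [hinc t ht]
      exact hw.step _
  · constructor
    · intro h
      have h1 : w s - w t ∈ K := by
        have := add_mem (sub_mem (hK h) (hwK s)) (hwK t)
        rwa [show w' s - w' t - (w' s - w s) + (w' t - w t) = w s - w t by abel] at this
      have h2 : s % n = t % n := (hw.sub_mem_iff _ _).mp h1
      have h3 : s / n ≡ t / n [MOD r] := by
        rw [← hβiff]
        simpa only [w', h2, add_sub_add_right_eq_sub] using h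
      change s % K'.index = t % K'.index
      rw [← hidx, mul_comm, Nat.mod_mul, Nat.mod_mul, h2, h3]
    · intro h
      change s % K'.index = t % K'.index at h
      rw [← hidx, mul_comm] at h
      have h2 : s % n = t % n := by
        rw [← Nat.mod_mul_right_mod s n r, h, Nat.mod_mul_right_mod]
      have h3 : s / n ≡ t / n [MOD r] := by
        change s / n % r = t / n % r
        rw [← Nat.mod_mul_right_div_self, h, Nat.mod_mul_right_div_self]
      simpa only [w', h2, add_sub_add_right_eq_sub] using (hβiff _ _).mpr h3
  · have h0 : K'.index - 1 = n * (r - 1) + (n - 1) := by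
      rw [← hidx]
      obtain ⟨r', hr'⟩ := Nat.exists_eq_add_of_lt hr
      rw [hr', zero_add, Nat.add_sub_cancel, add_mul, mul_comm n r', one_mul]
      omega
    have h1 : (K'.index - 1) / n = r - 1 := by
      rw [h0, Nat.mul_add_div hn, Nat.div_eq_of_lt (by omega), add_zero]
    have h2 : (K'.index - 1) % n = n - 1 := by
      rw [h0, Nat.mul_add_mod, Nat.mod_eq_of_lt (by omega)]
    simp only [w', h1, h2]
    have := add_mem (hβγ (r - 1)) hγl
    rwa [show β (r - 1) - γ (r - 1) + (γ (r - 1) - -(w (n - 1) + c)) =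
      β (r - 1) + w (n - 1) + c by abel] at this
  · change t < n at ht
    simp [w', Nat.div_eq_of_lt ht, Nat.mod_eq_of_lt ht, hβ0]

end IsCosetWalk

/-! ### A walk for a whole sequence of subgroups -/

namespace IsCosetWalk

variable {d : ℕ} {C : Set (Fin d → ℤ)} {c : Fin d → ℤ} {K K' : AddSubgroup (Fin d → ℤ)}
  {w w' w'' : ℕ → Fin d → ℤ}

theorem Extends.trans (h : Extends K w w') (h' : Extends K' w' w'') (hK : K' ≤ K)
    (hlt : K.index < K'.index) : Extends K w w'' where
  eq_of_lt t ht := (h'.eq_of_lt t (ht.trans hlt)).trans (h.eq_of_lt t ht)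
  sub_mem t := by
    have := add_mem (hK (h'.sub_mem t)) (h.sub_mem t)
    rwa [sub_add_sub_cancel] at this
  increment t ht := by
    have hdvd : K.index ∣ K'.index := AddSubgroup.index_dvd_of_le hK
    have h1 : ¬ K.index ∣ t % K'.index + 1 := by
      intro hh
      refine ht ?_
      rw [← Nat.div_add_mod t K'.index, add_assoc]
      exact dvd_add (hdvd.mul_right _) hh
    rw [h'.increment t fun hh => ht (hdvd.trans hh), h.increment _ h1, Nat.mod_mod_of_dvd t hdvd]

theorem Extends.sub_mem_iff (h : Extends K w w') (hw : IsCosetWalk C c K w) (s t : ℕ) :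
    w' s - w' t ∈ K ↔ s ≡ t [MOD K.index] := by
  rw [← hw.sub_mem_iff, show w' s - w' t = (w s - w t) + ((w' s - w s) - (w' t - w t)) by abel]
  exact K.add_mem_cancel_right (K.sub_mem (h.sub_mem s) (h.sub_mem t))

/-- A coset walk meets every coset. -/
theorem exists_sub_mem [K.FiniteIndex] (hw : IsCosetWalk C c K w) (v : Fin d → ℤ) :
    ∃ t, w t - v ∈ K := by
  have hkey : ∀ x y : Fin d → ℤ, (x : (Fin d → ℤ) ⧸ K) = y ↔ x - y ∈ K := fun x y => by
    rw [← sub_eq_zero, ← QuotientAddGroup.mk_sub, QuotientAddGroup.eq_zero_iff]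
  have := Fintype.ofFinite ((Fin d → ℤ) ⧸ K)
  have hbij : Function.Bijective fun t : Fin K.index => (w t : (Fin d → ℤ) ⧸ K) := by
    rw [Fintype.bijective_iff_injective_and_card]
    constructor
    · intro s t h
      have h1 := (hw.sub_mem_iff s t).mp ((hkey _ _).mp h)
      exact Fin.ext (h1.eq_of_lt_of_lt s.2 t.2)
    · rw [Fintype.card_fin, AddSubgroup.index, Nat.card_eq_fintype_card]
  obtain ⟨t, ht⟩ := hbij.2 v
  exact ⟨t, (hkey _ _).mp ht⟩

end IsCosetWalk

/-- A single walk that is a coset walk for each term of a sequence of subgroups cofinal with the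
`G_j`, the index of the `k`-th term being that of some `H_i` with `i ≥ k`. It is the union of
successive extensions; since sums of vectors of the cone are nonzero and the `G_j` have trivial
intersection, the next subgroup can be chosen with the end of the current period outside the
coset of `-c`, as the extension requires. -/
theorem OdometerSeq.exists_cosetWalk {d d' : ℕ} (hd : d ≠ 0) (G : OdometerSeq d)
    (H : OdometerSeq d') (hGH : ∀ j, ∃ i, (G.grp j).index ∣ (H.grp i).index)
    (hHG : ∀ i, ∃ j, (H.grp i).index ∣ (G.grp j).index)
    (hG : ∀ v ≠ 0, ∃ j, v ∉ G.grp j) {C : Set (Fin d → ℤ)} (hC : IsCone C) {c : Fin d → ℤ}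
    (hc : c ∈ C) :
    ∃ (K : ℕ → AddSubgroup (Fin d → ℤ)) (i : ℕ → ℕ) (W : ℕ → Fin d → ℤ),
      (∀ k, K k ≤ G.grp k) ∧ (∀ k, ∃ j, G.grp j ≤ K k) ∧ (∀ k, k ≤ i k) ∧
      (∀ k, (K k).index = (H.grp (i k)).index) ∧ (∀ k, IsCosetWalk C c (K k) W) ∧
      ∀ k t, ¬ (K k).index ∣ t + 1 →
        W (t + 1) - W t = W (t % (K k).index + 1) - W (t % (K k).index) := by
  have hfin := G.finiteIndex
  let State := {p : AddSubgroup (Fin d → ℤ) × (ℕ → Fin d → ℤ) //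
    IsCosetWalk C c p.1 p.2 ∧ ∃ j, G.grp j ≤ p.1}
  have hnext : ∀ (l : ℕ) (s : State), ∃ s' : State, s'.1.1 ≤ s.1.1 ∧ s'.1.1 ≤ G.grp l ∧
      (∃ i, l ≤ i ∧ s'.1.1.index = (H.grp i).index) ∧
      IsCosetWalk.Extends s.1.1 s.1.2 s'.1.2 ∧ s.1.1.index < s'.1.1.index := by
    rintro l ⟨⟨K, w⟩, hw, j₀, hj₀⟩
    obtain ⟨j₁, hj₁⟩ := hG _ fun h0 =>
      hC.zero_notMem (h0 ▸ hw.add_pos_mem hC hc (K.index - 1))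
    let J := max l (max j₀ j₁)
    obtain ⟨i₀, hi₀⟩ := hGH J
    obtain ⟨J₁, hJ₁⟩ := hHG (max l i₀)
    have hdvd : (G.grp J).index ∣ (H.grp (max l i₀)).index :=
      hi₀.trans (AddSubgroup.index_dvd_of_le (H.antitone_grp (le_max_right _ _)))
    obtain ⟨K', h1, h2, h3⟩ := AddSubgroup.exists_between_of_index_dvd
      (G.antitone_grp (le_max_left J J₁)) hdvd
      (hJ₁.trans (AddSubgroup.index_dvd_of_le (G.antitone_grp (le_max_right J J₁))))
    have : K'.FiniteIndex := AddSubgroup.finiteIndex_of_le h1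
    have hK : K' ≤ K := h2.trans ((G.antitone_grp
      ((le_max_left j₀ j₁).trans (le_max_right l _))).trans hj₀)
    have hlast : w (K.index - 1) + c ∉ K' := fun h =>
      hj₁ (G.antitone_grp ((le_max_right j₀ j₁).trans (le_max_right l _)) (h2 h))
    obtain ⟨w', hw', hext⟩ := hw.exists_extends hC hd hK hlast
    refine ⟨⟨(K', w'), hw', _, h1⟩, hK, h2.trans (G.antitone_grp (le_max_left _ _)),
      ⟨_, le_max_left _ _, h3⟩, hext, ?_⟩
    refine AddSubgroup.index_strictAnti (lt_of_le_of_ne hK fun h => hlast ?_)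
    change K' = K at h
    exact h ▸ hw.last
  choose next hle hleG hidx hext hlt using hnext
  have hinit : IsCosetWalk C c (⊤ : AddSubgroup (Fin d → ℤ)) fun t => t • c :=
    ⟨zero_nsmul c, fun t => by rwa [succ_nsmul, add_sub_cancel_left],
      fun s t => by simp [Nat.modEq_one], trivial⟩
  let s : ℕ → State := fun k => Nat.rec ⟨(⊤, fun t => t • c), hinit, 0, le_top⟩ next k
  let K : ℕ → AddSubgroup (Fin d → ℤ) := fun k => (s k).1.1
  let w : ℕ → ℕ → Fin d → ℤ := fun k => (s k).1.2
  have hw : ∀ k, IsCosetWalk C c (K k) (w k) := fun k => (s k).2.1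
  have hKanti : Antitone K := antitone_nat_of_succ_le fun k => hle k (s k)
  have hKlt : ∀ k, (K k).index < (K (k + 1)).index := fun k => hlt k (s k)
  have hKgt : ∀ k, k < (K k).index := fun k => by
    induction k with
    | zero =>
      have : K 0 = ⊤ := rfl
      simp [this]
    | succ k ih => exact lt_of_le_of_lt ih (hKlt k)
  have hE : ∀ k l, k < l → IsCosetWalk.Extends (K k) (w k) (w l) := by
    intro k l hkl
    induction l, hkl using Nat.le_induction with
    | base => exact hext k (s k)
    | succ l hkl ih =>
      refine ih.trans (hext l (s l)) (hKanti (Nat.le_of_succ_le hkl)) ?_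
      exact strictMono_nat_of_lt_succ (f := fun k => (K k).index) hKlt hkl
  let W : ℕ → Fin d → ℤ := fun t => w t t
  have hW : ∀ t l, t ≤ l → W t = w l t := fun t l htl => by
    rcases htl.eq_or_lt with rfl | h
    · rfl
    · exact ((hE t l h).eq_of_lt t (hKgt t)).symm
  have hwalk : ∀ k, IsCosetWalk C c (K k) W := fun k =>
    { zero := (hw 0).zero
      step := fun t => by
        rw [hW t (t + 1) t.le_succ]
        exact (hw (t + 1)).step t
      sub_mem_iff := fun a b => by
        have ha : a ≤ max (k + 1) (max a b) := by omega
        have hb : b ≤ max (k + 1) (max a b) := by omega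
        rw [hW a _ ha, hW b _ hb]
        exact (hE k _ (by omega)).sub_mem_iff (hw k) a b
      last := by
        have h1 := hW ((K k).index - 1) (max (k + 1) (K k).index) (by omega)
        have h2 := (hE k (max (k + 1) (K k).index) (by omega)).eq_of_lt ((K k).index - 1)
          (Nat.sub_lt (Nat.zero_lt_of_lt (hKgt k)) one_pos)
        rw [h1, h2]
        exact (hw k).last }
  choose i hi hKi using fun k => hidx k (s k)
  refine ⟨fun k => K (k + 1), i, W, fun k => hleG k (s k), fun k => (s (k + 1)).2.2, hi, hKi,
    fun k => hwalk (k + 1), fun k t ht => ?_⟩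
  set n := (K (k + 1)).index with hn
  have hmod : t % n < n := Nat.mod_lt _ (Nat.zero_lt_of_lt (hKgt (k + 1)))
  have hl1 : t + 1 ≤ max (k + 2) (max (t + 1) n) := by omega
  have hl2 : t % n + 1 ≤ max (k + 2) (max (t + 1) n) := by omega
  have hEl := hE (k + 1) (max (k + 2) (max (t + 1) n)) (by omega)
  have ht' : ¬ n ∣ t % n + 1 := fun h => ht (by
    rw [← Nat.div_add_mod t n, add_assoc]
    exact dvd_add (dvd_mul_right _ _) h)
  rw [hW _ _ hl1, hW _ _ (t.le_succ.trans hl1), hW _ _ hl2, hW _ _ ((t % n).le_succ.trans hl2),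
    hEl.increment t ht, hEl.increment _ ht', Nat.mod_mod]

/-! ### The homeomorphism of inverse limits -/

/-- In a quotient of `ℤ`, the multiples of the generator are classified by residues. -/
theorem mk_nsmul_eq_mk_nsmul_iff (K : AddSubgroup (Fin 1 → ℤ)) (s t : ℕ) :
    (((s • (1 : Fin 1 → ℤ) : Fin 1 → ℤ)) : (Fin 1 → ℤ) ⧸ K) = ((t • (1 : Fin 1 → ℤ) : Fin 1 → ℤ)) ↔
      s ≡ t [MOD K.index] := by
  have hgen : ∀ q : (Fin 1 → ℤ) ⧸ K,
      q ∈ AddSubgroup.zmultiples (((1 : Fin 1 → ℤ)) : (Fin 1 → ℤ) ⧸ K) := fun q => by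
    obtain ⟨v, rfl⟩ := QuotientAddGroup.mk_surjective q
    refine ⟨v 0, ?_⟩
    change ((v 0 • (1 : Fin 1 → ℤ) : Fin 1 → ℤ) : (Fin 1 → ℤ) ⧸ K) = v
    congr 1
    ext i
    simp [Subsingleton.elim i 0]
  rw [AddSubgroup.index, ← addOrderOf_eq_card_of_forall_mem_zmultiples hgen,
    ← nsmul_eq_nsmul_iff_modEq]
  rfl

theorem exists_nsmul_one_eq (K : AddSubgroup (Fin 1 → ℤ)) [K.FiniteIndex] (q : (Fin 1 → ℤ) ⧸ K) :
    ∃ t : ℕ, q = ((t • (1 : Fin 1 → ℤ) : Fin 1 → ℤ)) := by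
  obtain ⟨v, rfl⟩ := QuotientAddGroup.mk_surjective q
  have hn : (0 : ℤ) < (K.index : ℤ) := by
    exact_mod_cast Nat.pos_of_ne_zero K.index_ne_zero_of_finite
  refine ⟨(v 0 % K.index).toNat, ?_⟩
  rw [← sub_eq_zero, ← QuotientAddGroup.mk_sub, QuotientAddGroup.eq_zero_iff]
  have h : v - (v 0 % K.index).toNat • (1 : Fin 1 → ℤ) = K.index • fun _ => v 0 / K.index := by
    ext i
    have h1 := Int.emod_nonneg (v 0) hn.ne'
    have h2 := Int.emod_add_mul_ediv (v 0) K.index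
    have h3 : ((v 0 % (K.index : ℤ)).toNat : ℤ) = v 0 % K.index := Int.toNat_of_nonneg h1
    simp only [Subsingleton.elim i 0, Pi.sub_apply, Pi.smul_apply, Pi.one_apply]
    rw [nsmul_eq_mul, nsmul_eq_mul, h3, mul_one]
    linarith
  rw [h]
  exact K.nsmul_index_mem _

namespace OdometerSeq

/-- A walk that is a coset walk along a sequence of subgroups cofinal with the `G_j` induces a
homeomorphism of inverse limits, extending the map which sends the time `t` to the position `W t`. -/
theorem exists_homeomorph_of_cosetWalk {d : ℕ} (G : OdometerSeq d) (H : OdometerSeq 1)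
    {C : Set (Fin d → ℤ)} {c : Fin d → ℤ} {K : ℕ → AddSubgroup (Fin d → ℤ)} {i : ℕ → ℕ}
    {W : ℕ → Fin d → ℤ} (hKG : ∀ k, K k ≤ G.grp k) (hGK : ∀ k, ∃ j, G.grp j ≤ K k)
    (hi : ∀ k, k ≤ i k) (hidx : ∀ k, (K k).index = (H.grp (i k)).index)
    (hW : ∀ k, IsCosetWalk C c (K k) W) :
    ∃ Θ : H.Space ≃ₜ G.Space, ∀ (z : H.Space) (j t : ℕ),
      z.1 (i j) = (t • (1 : Fin 1 → ℤ) : Fin 1 → ℤ) → (Θ z).1 j = W t := by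
  have hfinH := H.finiteIndex
  have hfinK : ∀ k, (K k).FiniteIndex := fun k => ⟨by
    rw [hidx]
    exact (H.finiteIndex _).index_ne_zero⟩
  have hkey : ∀ j (x y : Fin d → ℤ), (x : (Fin d → ℤ) ⧸ G.grp j) = y ↔ x - y ∈ G.grp j :=
    fun j x y => by rw [← sub_eq_zero, ← QuotientAddGroup.mk_sub, QuotientAddGroup.eq_zero_iff]
  choose rep hrep using fun m => exists_nsmul_one_eq (H.grp m)
  let θ : H.Space → ∀ j, (Fin d → ℤ) ⧸ G.grp j := fun z j => W (rep (i j) (z.1 (i j)))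
  have hθ : ∀ (z : H.Space) (j t : ℕ),
      z.1 (i j) = (t • (1 : Fin 1 → ℤ) : Fin 1 → ℤ) → θ z j = W t := by
    intro z j t ht
    refine (hkey j _ _).mpr (hKG j (((hW j).sub_mem_iff _ _).mpr ?_))
    rw [hidx, ← mk_nsmul_eq_mk_nsmul_iff, ← hrep, ht]
  let Θ : H.Space → G.Space := fun z => ⟨θ z, fun j => by
    have h := hrep (max (i j) (i (j + 1))) (z.1 _)
    rw [hθ z j _ (H.coord_eq_of_le z (le_max_left _ _) h),
      hθ z (j + 1) _ (H.coord_eq_of_le z (le_max_right _ _) h)]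
    rfl⟩
  have hcont : Continuous Θ := by
    refine Continuous.subtype_mk (continuous_pi fun j => ?_) _
    exact (continuous_of_discreteTopology
      (f := fun q => ((W (rep (i j) q) : Fin d → ℤ) : (Fin d → ℤ) ⧸ G.grp j))).comp
      (H.continuous_coord (i j))
  have hinj : Function.Injective Θ := by
    intro z z' h
    refine H.space_ext fun m => H.coord_eq_coord_of_le z z' (hi m) ?_
    obtain ⟨j, hj⟩ := hGK m
    have hz := hrep (max (i j) (i m)) (z.1 _)
    have hz' := hrep (max (i j) (i m)) (z'.1 _)
    have h1 : θ z j = θ z' j := congrFun (congrArg Subtype.val h) j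
    rw [hθ z j _ (H.coord_eq_of_le z (le_max_left _ _) hz),
      hθ z' j _ (H.coord_eq_of_le z' (le_max_left _ _) hz'), hkey] at h1
    have h2 := ((hW m).sub_mem_iff _ _).mp (hj h1)
    rw [hidx, ← mk_nsmul_eq_mk_nsmul_iff] at h2
    rw [H.coord_eq_of_le z (le_max_right _ _) hz, h2, H.coord_eq_of_le z' (le_max_right _ _) hz']
  have hsurj : Function.Surjective Θ := by
    intro x
    have hcl : ∀ j, IsClosed {z : H.Space | (Θ z).1 j = x.1 j} := fun j =>
      isClosed_singleton.preimage ((G.continuous_coord j).comp hcont)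
    obtain ⟨z, hz⟩ := IsCompact.nonempty_iInter_of_sequence_nonempty_isCompact_isClosed
      (fun j => {z : H.Space | (Θ z).1 j = x.1 j})
      (fun j z hz => G.coord_eq_coord_of_le _ _ j.le_succ hz)
      (fun j => by
        obtain ⟨v, hv⟩ := QuotientAddGroup.mk_surjective (x.1 j)
        obtain ⟨t, ht⟩ := (hW j).exists_sub_mem v
        refine ⟨H.ofVec (t • (1 : Fin 1 → ℤ)), ?_⟩
        change θ _ j = x.1 j
        rw [hθ _ j t rfl, ← hv, hkey]
        exact hKG j ht)
      (hcl 0).isCompact hcl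
    exact ⟨z, G.space_ext fun j => Set.mem_iInter.mp hz j⟩
  exact ⟨Continuous.homeoOfEquivCompactToT2 (f := Equiv.ofBijective Θ ⟨hinj, hsurj⟩) hcont, hθ⟩

/-- If the indices of the `H_i` and of the `G_j` divide one another cofinally, and the `G_j` have
trivial intersection, the `ℤ`-odometer of the `H_i` can be realized on the inverse limit of the
`ℤ^d / G_j` so that its generator moves each point by a vector of the cone. -/
theorem exists_homeomorph_shift_mem_cone {d : ℕ} (hd : d ≠ 0) (G : OdometerSeq d)
    (H : OdometerSeq 1) (hGH : ∀ j, ∃ i, (G.grp j).index ∣ (H.grp i).index)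
    (hHG : ∀ i, ∃ j, (H.grp i).index ∣ (G.grp j).index)
    (hG : ∀ v ≠ 0, ∃ j, v ∉ G.grp j) {C : Set (Fin d → ℤ)} (hC : IsCone C) :
    ∃ Θ : H.Space ≃ₜ G.Space, ∀ z, ∃ v ∈ C, Θ (H.shift 1 z) = G.shift v (Θ z) := by
  have hfinH := H.finiteIndex
  obtain ⟨c, hc, -⟩ := hC.exists_sub_mem hd ⊤ 0
  obtain ⟨K, i, W, hKG, hGK, hi, hidx, hW, hinc⟩ := G.exists_cosetWalk hd H hGH hHG hG hC hc
  obtain ⟨Θ, hΘ⟩ := G.exists_homeomorph_of_cosetWalk H hKG hGK hi hidx hW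
  have hpos : ∀ k, 0 < (K k).index := fun k => by
    rw [hidx]
    exact Nat.pos_of_ne_zero (H.finiteIndex _).index_ne_zero
  refine ⟨Θ, fun z => ?_⟩
  have hsucc : ∀ m t : ℕ, z.1 m = (t • (1 : Fin 1 → ℤ) : Fin 1 → ℤ) →
      (H.shift 1 z).1 m = ((t + 1) • (1 : Fin 1 → ℤ) : Fin 1 → ℤ) := fun m t h => by
    rw [shift_coord, h, succ_nsmul, QuotientAddGroup.mk_add]
  by_cases hz : ∃ k t : ℕ, z.1 (i k) = (t • (1 : Fin 1 → ℤ) : Fin 1 → ℤ) ∧ ¬ (K k).index ∣ t + 1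
  · obtain ⟨k, t, ht, hdvd⟩ := hz
    refine ⟨_, (hW k).step (t % (K k).index), G.space_ext fun j => ?_⟩
    -- a common representative of the coordinates of levels `i j` and `i k`
    obtain ⟨a, ha⟩ := exists_nsmul_one_eq _ (z.1 (max (i j) (i k)))
    have haj := H.coord_eq_of_le z (le_max_left _ _) ha
    have hak := H.coord_eq_of_le z (le_max_right _ _) ha
    have hmod : a ≡ t [MOD (K k).index] := by
      rw [hidx, ← mk_nsmul_eq_mk_nsmul_iff, ← hak, ht]
    have hmod' : a % (K k).index = t % (K k).index := hmod
    have hdvd' : ¬ (K k).index ∣ a + 1 := fun h =>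
      hdvd (((hmod.add_right 1).dvd_iff dvd_rfl).mp h)
    rw [hΘ _ j _ (hsucc _ _ haj), shift_coord, hΘ _ j _ haj, ← hmod', ← hinc k a hdvd',
      ← QuotientAddGroup.mk_add, add_sub_cancel]
  · push Not at hz
    -- in the remaining case `z` is the point `-1`, whose image is `-c`
    refine ⟨c, hc, G.space_ext fun j => ?_⟩
    obtain ⟨t, ht⟩ := exists_nsmul_one_eq _ (z.1 (i j))
    have hdvd := hz j t ht
    have h0 : (H.shift 1 z).1 (i j) = ((0 : ℕ) • (1 : Fin 1 → ℤ) : Fin 1 → ℤ) := by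
      rw [hsucc _ _ ht, mk_nsmul_eq_mk_nsmul_iff, ← hidx]
      exact (Nat.modEq_zero_iff_dvd).mpr hdvd
    have hlast : z.1 (i j) = (((K j).index - 1) • (1 : Fin 1 → ℤ) : Fin 1 → ℤ) := by
      rw [ht, mk_nsmul_eq_mk_nsmul_iff, ← hidx]
      refine Nat.ModEq.add_right_cancel' 1 ?_
      rw [Nat.sub_add_cancel (hpos j)]
      exact ((Nat.modEq_zero_iff_dvd).mpr hdvd).trans (Nat.modEq_zero_iff_dvd.mpr dvd_rfl).symm
    rw [hΘ _ j _ h0, shift_coord, hΘ _ j _ hlast, (hW j).zero, ← QuotientAddGroup.mk_add, eq_comm]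
    exact (QuotientAddGroup.eq_zero_iff _).mpr (hKG j (hW j).last)

end OdometerSeq

/-! ### Speedups from freeness -/

/-- If the generator of a `ℤ`-action moves each point along a free action by a vector of `C`, then
the `ℤ`-action is a `C`-speedup: freeness makes the speedup cocycle unique, hence a cocycle. -/
theorem ZdAction.isConeSpeedup_of_forall_exists {d : ℕ} {X : Type*} [TopologicalSpace X]
    (T : ZdAction d X) (hT : T.IsFree) (S : ZdAction 1 X) {C : Set (Fin d → ℤ)}
    (h : ∀ x, ∃ v ∈ C, S.map 1 x = T.map v x) : T.IsConeSpeedup S C := by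
  have huniq : ∀ x v w, T.map v x = T.map w x → v = w := fun x v w hvw => by
    have h2 : T.map (v - w) (T.map w x) = T.map w x := by
      rw [← T.map_add, sub_add_cancel, hvw]
    exact sub_eq_zero.mp (hT _ _ h2)
  have hnat : ∀ (n : ℕ) x, ∃ v, S.map (n • 1) x = T.map v x := by
    intro n
    induction n with
    | zero => exact fun x => ⟨0, by rw [zero_nsmul, S.map_zero, T.map_zero]⟩
    | succ n ih =>
      intro x
      obtain ⟨v, hv⟩ := ih x
      obtain ⟨u, -, hu⟩ := h (T.map v x)
      exact ⟨u + v, by rw [succ_nsmul', S.map_add, hv, hu, T.map_add]⟩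
  have hall : ∀ x (n : Fin 1 → ℤ), ∃ v, S.map n x = T.map v x := by
    intro x n
    obtain ⟨m, hm | hm⟩ : ∃ m : ℕ, n = m • 1 ∨ n = -(m • 1) := by
      refine ⟨(n 0).natAbs, ?_⟩
      rcases Int.natAbs_eq (n 0) with h0 | h0
      · left; ext i; simpa [Subsingleton.elim i 0] using h0
      · right; ext i; simpa [Subsingleton.elim i 0] using h0
    · rw [hm]
      exact hnat m x
    · obtain ⟨v, hv⟩ := hnat m (S.map n x)
      refine ⟨-v, ?_⟩
      rw [← S.map_add, hm, add_neg_cancel, S.map_zero, ← hm] at hv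
      conv_rhs => rw [hv, ← T.map_add, neg_add_cancel, T.map_zero]
  choose p hp using hall
  refine ⟨p, ⟨⟨fun x => huniq x _ _ ?_, fun x v w => huniq x _ _ ?_⟩, fun v x => hp x v⟩,
    fun x j => ?_⟩
  · rw [← hp, S.map_zero, T.map_zero]
  · rw [← hp, add_comm (p x v), T.map_add, ← hp, ← hp, ← S.map_add, add_comm]
    exact hp x (v + w)
  · obtain ⟨v, hv, hvx⟩ := h x
    have hj : (Pi.single j 1 : Fin 1 → ℤ) = 1 := by
      ext i
      simp [Subsingleton.elim i j]
    rwa [hj, huniq x (p x 1) v (by rw [← hp, hvx])]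

theorem ZdAction.IsFree.of_conjugate {d : ℕ} {X : Type*} {Y : Type*} [TopologicalSpace X]
    [TopologicalSpace Y] {T : ZdAction d X} {S : ZdAction d Y} (hT : T.IsFree) (Φ : X ≃ₜ Y)
    (hΦ : ∀ v x, Φ (T.map v x) = S.map v (Φ x)) : S.IsFree := by
  intro y v hy
  refine hT (Φ.symm y) v (Φ.injective ?_)
  rw [hΦ, Φ.apply_symm_apply, hy]

theorem theorem4p3 {d : ℕ} {X₁ : Type u} {X₂ : Type v} [TopologicalSpace X₁] [TopologicalSpace X₂]
    (T₁ : ZdAction d X₁) (T₂ : ZdAction 1 X₂)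
    (h₁ : T₁.IsOdometer) (hfree₁ : T₁.IsFree)
    (h₂ : T₂.IsOdometer) (hfree₂ : T₂.IsFree)
    (hoe : T₁.OrbitEquivalent T₂)
    (C : Set (Fin d → ℤ)) (hC : IsCone C) :
    ∃ S : ZdAction 1 X₁, T₁.IsConeSpeedup S C ∧ S.Conjugate T₂ := by
  obtain ⟨G, Φ₁, hΦ₁⟩ := h₁
  obtain ⟨H, Φ₂, hΦ₂⟩ := h₂
  obtain ⟨Ψ, hΨ⟩ := hoe
  have hGfree := hfree₁.of_conjugate Φ₁ hΦ₁
  have hHfree := hfree₂.of_conjugate Φ₂ hΦ₂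
  have hΦ₁' : ∀ v x, Φ₁.symm (G.shift v x) = T₁.map v (Φ₁.symm x) := fun v x => by
    rw [Homeomorph.symm_apply_eq, hΦ₁, Φ₁.apply_symm_apply]
    rfl
  have hΦ₂' : ∀ v x, Φ₂.symm (H.shift v x) = T₂.map v (Φ₂.symm x) := fun v x => by
    rw [Homeomorph.symm_apply_eq, hΦ₂, Φ₂.apply_symm_apply]
    rfl
  let Ω : G.Space ≃ₜ H.Space := (Φ₁.symm.trans Ψ).trans Φ₂
  have hd : d ≠ 0 := by
    rintro rfl
    -- a free `ℤ^0`-odometer is a single point, on which `ℤ` cannot act freely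
    have hsub : ∀ x y : G.Space, x = y := fun x y => G.space_ext fun j => by
      obtain ⟨v, hv⟩ := QuotientAddGroup.mk_surjective (x.1 j)
      obtain ⟨w, hw⟩ := QuotientAddGroup.mk_surjective (y.1 j)
      rw [← hv, ← hw, Subsingleton.elim v w]
    have h10 := hHfree 0 1 (Ω.symm.injective (hsub _ _))
    exact one_ne_zero (congrFun h10 0)
  have hGH : ∀ j, ∃ i, (G.grp j).index ∣ (H.grp i).index := by
    refine G.exists_index_dvd_index H hHfree Ω.symm fun x v => ?_
    have h : Ψ (T₁.map v (Φ₁.symm x)) ∈ T₂.orbit (Ψ (Φ₁.symm x)) := by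
      rw [← hΨ]
      exact ⟨_, ⟨v, rfl⟩, rfl⟩
    obtain ⟨w, hw⟩ := h
    refine ⟨w, ?_⟩
    change H.action.map w (Φ₂ (Ψ (Φ₁.symm x))) = Φ₂ (Ψ (Φ₁.symm (G.shift v x)))
    rw [hΦ₁', ← hΦ₂]
    exact congrArg Φ₂ hw
  have hHG : ∀ i, ∃ j, (H.grp i).index ∣ (G.grp j).index := by
    refine H.exists_index_dvd_index G hGfree Ω fun y v => ?_
    have h : T₂.map v (Φ₂.symm y) ∈ Ψ '' T₁.orbit (Ψ.symm (Φ₂.symm y)) := by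
      rw [hΨ, Ψ.apply_symm_apply]
      exact ⟨v, rfl⟩
    obtain ⟨_, ⟨w, rfl⟩, hw⟩ := h
    refine ⟨w, ?_⟩
    change G.action.map w (Φ₁ (Ψ.symm (Φ₂.symm y))) = Φ₁ (Ψ.symm (Φ₂.symm (H.shift v y)))
    rw [hΦ₂', ← hΦ₁, ← hw]
    exact congrArg Φ₁ (Ψ.symm_apply_apply _).symm
  obtain ⟨Θ, hΘ⟩ := G.exists_homeomorph_shift_mem_cone hd H hGH hHG
    (fun _ hv => G.exists_notMem_of_isFree hGfree hv) hC
  let Λ : X₁ ≃ₜ X₂ := (Φ₁.trans Θ.symm).trans Φ₂.symm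
  let S : ZdAction 1 X₁ :=
    { map := fun n => (Λ.trans (T₂.map n)).trans Λ.symm
      map_zero := fun x => by simp [T₂.map_zero]
      map_add := fun a b x => by simp [T₂.map_add] }
  refine ⟨S, T₁.isConeSpeedup_of_forall_exists hfree₁ S fun x => ?_, Λ, fun n x =>
    Λ.apply_symm_apply _⟩
  obtain ⟨v, hv, h⟩ := hΘ (Θ.symm (Φ₁ x))
  refine ⟨v, hv, ?_⟩
  change Φ₁.symm (Θ (Φ₂ (T₂.map 1 (Φ₂.symm (Θ.symm (Φ₁ x)))))) = _
  rw [hΦ₂, Φ₂.apply_symm_apply, OdometerSeq.action_map_apply, h, hΦ₁', Θ.apply_symm_apply,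
    Φ₁.symm_apply_apply]
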